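/- The James space $J$ is the Banach space of all real sequences $x=(x(n))_{n\in\mathbb N}$ with $$\|x\|=\sup\Big\{\Big(\sum_{i=1}^{m}\Big|\sum_{k\in I_i}x(k)\Big|^2\Big)^{1/2} : m\in\mathbb N,\ I_1,\dots,I_m \text{ pairwise disjoint finite intervals of } \mathbb N\Big\}<\infty ,$$ and $(e_n)_n$ denotes its standard unit vector basis. A sequence $(x_n)_n$ in a Banach space $X$ is called non-trivial weakly Cauchy if its image in $X^{**}$ converges weak$^*$ to some $x^{**}\in X^{**}\setminus X$. A sequence $(x_k)_k$ in $J$ is equivalent to the basis of $J$ if there are constants $c,C>0$ such that $c\,\|\sum_k a_k e_k\|\le\|\sum_k a_k x_k\|\le C\,\|\sum_k a_k e_k\|$ for all finitely supported real sequences $(a_k)_k$. A closed subspace of $J$ is complemented in $J$ if it is the range of a bounded linear projection on $J$. (i) Every non-trivial weakly Cauchy sequence $(x_n)_n$ in $J$ has a subsequence $(x_{n_k})_k$ that is equivalent to the basis $(e_k)_k$ of $J$ and whose closed linear span $[x_{n_k}]_k$ is complemented in $J$. (ii) Every non-reflexive closed subspace $Z$ of $J$ contains a closed subspace that is linearly homeomorphic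 to $J$ and complemented in $J$. -/

import Mathlib

open Filter Topology

noncomputable section

/-- A finite family of pairwise disjoint finite intervals of `ℕ`. The empty interval is allowed;
it contributes nothing to the sums below. -/
def IsIntervalFamily (P : Finset (Finset ℕ)) : Prop :=
  (∀ I ∈ P, (I : Set ℕ).OrdConnected) ∧ (P : Set (Finset ℕ)).PairwiseDisjoint id

/-- The quantity `(∑_{I ∈ P} |∑_{k ∈ I} x(k)|²)^{1/2}`. -/
def intervalNorm (P : Finset (Finset ℕ)) (x : ℕ → ℝ) : ℝ :=
  √(∑ I ∈ P, |∑ k ∈ I, x k| ^ 2)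

/-- All values `(∑_{I ∈ P} |∑_{k ∈ I} x(k)|²)^{1/2}` for finite families `P` of pairwise disjoint
intervals; the James norm of `x` is the supremum of this set. -/
def jamesValues (x : ℕ → ℝ) : Set ℝ :=
  {r | ∃ P, IsIntervalFamily P ∧ r = intervalNorm P x}

lemma intervalNorm_nonneg (P : Finset (Finset ℕ)) (x : ℕ → ℝ) : 0 ≤ intervalNorm P x :=
  Real.sqrt_nonneg _

lemma intervalNorm_eq (P : Finset (Finset ℕ)) (x : ℕ → ℝ) :
    intervalNorm P x
      = ‖(WithLp.toLp 2 (fun I : P => ∑ k ∈ (I : Finset ℕ), x k) : EuclideanSpace ℝ P)‖ := by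
  rw [EuclideanSpace.norm_eq]
  simp only [intervalNorm, Real.norm_eq_abs]
  rw [← Finset.sum_coe_sort P]

lemma intervalNorm_add_le (P : Finset (Finset ℕ)) (x y : ℕ → ℝ) :
    intervalNorm P (x + y) ≤ intervalNorm P x + intervalNorm P y := by
  simp only [intervalNorm_eq]
  refine le_trans (le_of_eq ?_) (norm_add_le _ _)
  congr 1
  ext I
  simp [Finset.sum_add_distrib]

lemma intervalNorm_smul (P : Finset (Finset ℕ)) (c : ℝ) (x : ℕ → ℝ) :
    intervalNorm P (c • x) = |c| * intervalNorm P x := by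
  simp only [intervalNorm_eq]
  rw [← Real.norm_eq_abs, ← norm_smul]
  congr 1
  ext I
  simp [Finset.mul_sum]

lemma isIntervalFamily_empty : IsIntervalFamily ∅ := by
  simp [IsIntervalFamily]

lemma isIntervalFamily_singleton (n : ℕ) : IsIntervalFamily {{n}} := by
  simp [IsIntervalFamily, Set.ordConnected_singleton]

lemma jamesValues_nonempty (x : ℕ → ℝ) : (jamesValues x).Nonempty :=
  ⟨_, ∅, isIntervalFamily_empty, rfl⟩

/-- The sequences of real numbers whose James norm is finite. -/
def jamesSubmodule : Submodule ℝ (ℕ → ℝ) where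
  carrier := {x | BddAbove (jamesValues x)}
  zero_mem' := by
    refine ⟨0, ?_⟩
    rintro r ⟨P, -, rfl⟩
    simp [intervalNorm]
  add_mem' := by
    rintro x y ⟨A, hA⟩ ⟨B, hB⟩
    refine ⟨A + B, ?_⟩
    rintro r ⟨P, hP, rfl⟩
    exact (intervalNorm_add_le P x y).trans (add_le_add (hA ⟨P, hP, rfl⟩) (hB ⟨P, hP, rfl⟩))
  smul_mem' := by
    rintro c x ⟨A, hA⟩
    refine ⟨|c| * A, ?_⟩
    rintro r ⟨P, hP, rfl⟩
    rw [intervalNorm_smul]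
    exact mul_le_mul_of_nonneg_left (hA ⟨P, hP, rfl⟩) (abs_nonneg c)

/-- The James space `J`. It is a type of its own, so that it carries the topology of the James norm
and not that of pointwise convergence. -/
def JamesSpace : Type := jamesSubmodule

namespace JamesSpace

instance : AddCommGroup JamesSpace := inferInstanceAs (AddCommGroup jamesSubmodule)

instance : Module ℝ JamesSpace := inferInstanceAs (Module ℝ jamesSubmodule)

/-- The underlying sequence of an element of `J`. -/
def coord (x : JamesSpace) : ℕ → ℝ := x.1

lemma bddAbove (x : JamesSpace) : BddAbove (jamesValues x.coord) := x.2

lemma coord_add (x y : JamesSpace) : (x + y).coord = x.coord + y.coord := rfl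

lemma coord_smul (c : ℝ) (x : JamesSpace) : (c • x).coord = c • x.coord := rfl

lemma coord_injective : Function.Injective coord := Subtype.coe_injective

/-- The James norm: the supremum of `(∑_i |∑_{k ∈ I_i} x(k)|²)^{1/2}` over the finite families
`(I_i)` of pairwise disjoint intervals of `ℕ`. -/
instance : Norm JamesSpace := ⟨fun x => sSup (jamesValues x.coord)⟩

lemma norm_def (x : JamesSpace) : ‖x‖ = sSup (jamesValues x.coord) := rfl

lemma intervalNorm_le_norm (x : JamesSpace) {P : Finset (Finset ℕ)} (hP : IsIntervalFamily P) :
    intervalNorm P x.coord ≤ ‖x‖ :=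
  le_csSup x.bddAbove ⟨P, hP, rfl⟩

lemma norm_le_of_forall (x : JamesSpace) {C : ℝ}
    (h : ∀ P, IsIntervalFamily P → intervalNorm P x.coord ≤ C) : ‖x‖ ≤ C := by
  refine csSup_le (jamesValues_nonempty _) ?_
  rintro r ⟨P, hP, rfl⟩
  exact h P hP

lemma norm_nonneg' (x : JamesSpace) : 0 ≤ ‖x‖ :=
  (intervalNorm_nonneg _ _).trans (x.intervalNorm_le_norm isIntervalFamily_empty)

lemma abs_coord_le_norm (x : JamesSpace) (n : ℕ) : |x.coord n| ≤ ‖x‖ := by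
  have h := x.intervalNorm_le_norm (isIntervalFamily_singleton n)
  simpa [intervalNorm, Real.sqrt_sq_eq_abs] using h

lemma norm_smul_le' (c : ℝ) (x : JamesSpace) : ‖c • x‖ ≤ |c| * ‖x‖ := by
  refine norm_le_of_forall _ fun P hP => ?_
  rw [coord_smul, intervalNorm_smul]
  exact mul_le_mul_of_nonneg_left (x.intervalNorm_le_norm hP) (abs_nonneg c)

lemma normCore : NormedSpace.Core ℝ JamesSpace where
  norm_nonneg := norm_nonneg'
  norm_smul c x := by
    rw [Real.norm_eq_abs]
    refine le_antisymm (norm_smul_le' c x) ?_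
    rcases eq_or_ne c 0 with rfl | hc
    · simpa using norm_nonneg' _
    · have h := norm_smul_le' c⁻¹ (c • x)
      rw [smul_smul, inv_mul_cancel₀ hc, one_smul, abs_inv] at h
      have hc' : 0 < |c| := abs_pos.mpr hc
      calc |c| * ‖x‖ ≤ |c| * (|c|⁻¹ * ‖c • x‖) := mul_le_mul_of_nonneg_left h hc'.le
        _ = ‖c • x‖ := by rw [← mul_assoc, mul_inv_cancel₀ hc'.ne', one_mul]
  norm_triangle x y := by
    refine norm_le_of_forall _ fun P hP => ?_
    rw [coord_add]
    exact (intervalNorm_add_le P _ _).trans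
      (add_le_add (x.intervalNorm_le_norm hP) (y.intervalNorm_le_norm hP))
  norm_eq_zero_iff x := by
    constructor
    · intro h
      apply coord_injective
      funext n
      have := x.abs_coord_le_norm n
      rw [h] at this
      exact abs_eq_zero.mp (le_antisymm this (abs_nonneg _))
    · rintro rfl
      refine le_antisymm (norm_le_of_forall _ fun P _ => ?_) (norm_nonneg' _)
      have : coord 0 = 0 := rfl
      simp [this, intervalNorm]

instance : NormedAddCommGroup JamesSpace := NormedAddCommGroup.ofCore normCore

instance : NormedSpace ℝ JamesSpace := NormedSpace.ofCore normCore

lemma single_mem (n : ℕ) : (Pi.single n 1 : ℕ → ℝ) ∈ jamesSubmodule := by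
  refine ⟨1, ?_⟩
  rintro r ⟨P, hP, rfl⟩
  refine Real.sqrt_le_one.mpr ?_
  have h : ∀ I ∈ P, |∑ k ∈ I, (Pi.single n 1 : ℕ → ℝ) k| ^ 2 = if n ∈ I then 1 else 0 := by
    intro I _
    simp only [Pi.single_apply, Finset.sum_ite_eq']
    split_ifs <;> simp
  rw [Finset.sum_congr rfl h, Finset.sum_boole]
  norm_cast
  rw [Finset.card_le_one]
  intro I hI I' hI'
  rw [Finset.mem_filter] at hI hI'
  exact hP.2.elim_finset hI.1 hI'.1 n hI.2 hI'.2

/-- The unit vectors `e_n`, which form the standard basis of `J`. -/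
def e (n : ℕ) : JamesSpace := ⟨Pi.single n 1, single_mem n⟩

end JamesSpace

section BanachSpaceNotions

variable {X Y : Type*} [NormedAddCommGroup X] [NormedSpace ℝ X]
  [NormedAddCommGroup Y] [NormedSpace ℝ Y]

/-- A sequence in `X` is non-trivial weakly Cauchy if its image under the canonical embedding
`X → X**` is weak-star convergent to an element of `X** \ X`. -/
def IsNontrivialWeaklyCauchy (x : ℕ → X) : Prop :=
  ∃ z : StrongDual ℝ (StrongDual ℝ X),
    z ∉ Set.range (NormedSpace.inclusionInDoubleDual ℝ X) ∧
    Tendsto (fun n => StrongDual.toWeakDual (NormedSpace.inclusionInDoubleDual ℝ X (x n)))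
      atTop (𝓝 (StrongDual.toWeakDual z))

/-- Equivalence of sequences: `c ‖∑ aₙ yₙ‖ ≤ ‖∑ aₙ xₙ‖ ≤ C ‖∑ aₙ yₙ‖` for all finitely supported
scalar sequences `a`, with constants `c, C > 0` that do not depend on `a`. -/
def SeqEquivalent (x : ℕ → X) (y : ℕ → Y) : Prop :=
  ∃ c C : ℝ, 0 < c ∧ 0 < C ∧ ∀ a : ℕ →₀ ℝ,
    c * ‖Finsupp.linearCombination ℝ y a‖ ≤ ‖Finsupp.linearCombination ℝ x a‖ ∧
    ‖Finsupp.linearCombination ℝ x a‖ ≤ C * ‖Finsupp.linearCombination ℝ y a‖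

/-- The closed linear span `[xₙ]` of a sequence. -/
def closedSpan (x : ℕ → X) : Submodule ℝ X :=
  (Submodule.span ℝ (Set.range x)).topologicalClosure

variable (X) in
/-- `X` is reflexive if the canonical embedding `X → X**` is onto. -/
def IsReflexiveSpace : Prop :=
  Function.Surjective (NormedSpace.inclusionInDoubleDual ℝ X)

end BanachSpaceNotions

end

/-!
The unit vectors of `J` are a boundedly complete basis: a bounded coordinatewise limit of elements
of `J` lies in `J`, and tails of elements tend to `0`. Besides the coordinates, the only relevant
functional is the sum `sumL x = ∑ₖ x(k)`, which takes the value `1` at every unit vector.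

Let `x n` be a bounded sequence with coordinatewise limit `x₀` and `sumL (x n) → μ`, and put
`l = μ - sumL x₀`. A gliding hump argument (`exists_subsequence_eq_blocks`) writes a subsequence of
`x n - x₀` as `l • e (m k) + w k + d k`, where `d` is small in norm and `w k` is a bounded vector
on the block `[m k, m (k + 1))` whose coordinates have sum zero. An interval of `ℕ` only sees the
(at most two) vectors `w k` whose blocks it cuts, whence the upper `ℓ²` estimate
`IsZeroSumBlocks.norm_sum_smul_le`. There are two cases.

* If `l = 0`, the `ℓ²` estimate shows that a functional that converges along `x n` converges to its
  value at `x₀` (`eq_of_tendsto_of_sumL`). This is excluded for a non-trivial weakly Cauchy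
  sequence.
* If `l ≠ 0`, there is an operator `T` with `T (e k) = x (φ k)`, namely
  `T = sumL(·) x₀ + l S + W + E` with `S (e k) = e (m k)`, `W (e k) = w k` and `E (e k) = d k`.
  The operator `R` that sums a sequence over the blocks is bounded because unions of consecutive
  blocks are intervals. It satisfies `R S = 1` and `R W = 0`, and it only sees the part of `x₀`
  beyond `m 0`. So `l⁻¹ R T` is within distance less than `1` of the identity, and `T` has a bounded
  left inverse (`exists_leftInverse_of_sumL_ne`). Hence `T` is an isomorphism onto its range, which
  is the closed span of `x (φ k)`, and its range is complemented.

For a closed subspace `Z` with a bidual element `z` outside `Z`, Helly's theorem provides bounded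
sequences in `Z` along which the coordinates, the sum, and one more functional `f` tend to the
values prescribed by `z`. If `l` were `0`, then `z` would act on every `f` as evaluation at `x₀`,
and the Hahn–Banach theorem would place `x₀` in `Z` and identify it with `z`. So `l ≠ 0`, and the
second case applies inside `Z`.
-/

noncomputable section

namespace JamesSpace

/-! ### The James norm -/

/-- The square sum estimate for an indexed family of pairwise disjoint intervals, in which empty
intervals may repeat. -/
lemma sum_sq_le_norm_sq {ι : Type*} (x : JamesSpace) (s : Finset ι) (I : ι → Finset ℕ)
    (hI : ∀ i ∈ s, (I i : Set ℕ).OrdConnected) (hd : (s : Set ι).PairwiseDisjoint I) :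
    ∑ i ∈ s, (∑ k ∈ I i, x.coord k) ^ 2 ≤ ‖x‖ ^ 2 := by
  classical
  have hP : IsIntervalFamily (s.image I) := by
    refine ⟨?_, ?_⟩
    · intro J hJ
      obtain ⟨i, hi, rfl⟩ := Finset.mem_image.mp hJ
      exact hI i hi
    · rw [Finset.coe_image]
      rintro _ ⟨i, hi, rfl⟩ _ ⟨j, hj, rfl⟩ hij
      exact hd hi hj fun h => hij (h ▸ rfl)
  have h := x.intervalNorm_le_norm hP
  rw [intervalNorm, Real.sqrt_le_left (norm_nonneg x)] at h
  simp only [sq_abs] at h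
  rwa [Finset.sum_image_of_disjoint (by simp) hd] at h

lemma sum_sq_le_norm_sq_of_isIntervalFamily (x : JamesSpace) {P : Finset (Finset ℕ)}
    (hP : IsIntervalFamily P) : ∑ I ∈ P, (∑ k ∈ I, x.coord k) ^ 2 ≤ ‖x‖ ^ 2 :=
  x.sum_sq_le_norm_sq P id hP.1 hP.2

lemma intervalNorm_le_of_sum_sq_le {P : Finset (Finset ℕ)} {x : ℕ → ℝ} {C : ℝ} (hC : 0 ≤ C)
    (h : ∑ I ∈ P, (∑ k ∈ I, x k) ^ 2 ≤ C ^ 2) : intervalNorm P x ≤ C := by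
  rw [intervalNorm, Real.sqrt_le_left hC]
  simpa only [sq_abs] using h

lemma norm_le_of_sum_sq_le (x : JamesSpace) {C : ℝ} (hC : 0 ≤ C)
    (h : ∀ P, IsIntervalFamily P → ∑ I ∈ P, (∑ k ∈ I, x.coord k) ^ 2 ≤ C ^ 2) : ‖x‖ ≤ C :=
  x.norm_le_of_forall fun P hP => intervalNorm_le_of_sum_sq_le hC (h P hP)

lemma abs_sum_coord_le_norm (x : JamesSpace) {I : Finset ℕ} (hI : (I : Set ℕ).OrdConnected) :
    |∑ k ∈ I, x.coord k| ≤ ‖x‖ := by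
  have h := x.sum_sq_le_norm_sq {()} (fun _ => I) (fun _ _ => hI) (by simp)
  simp only [Finset.sum_singleton] at h
  exact abs_le_of_sq_le_sq h (norm_nonneg x)

lemma sum_coord_sq_le (x : JamesSpace) (s : Finset ℕ) :
    ∑ k ∈ s, x.coord k ^ 2 ≤ ‖x‖ ^ 2 := by
  have h := x.sum_sq_le_norm_sq s (fun k => {k})
    (fun _ _ => by simpa using Set.ordConnected_singleton)
    (fun i _ j _ hij => by simpa using hij)
  simpa using h

@[simp] lemma coord_zero (n : ℕ) : coord 0 n = 0 := rfl

@[simp] lemma coord_sub (x y : JamesSpace) : (x - y).coord = x.coord - y.coord := rfl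

attribute [simp] coord_add coord_smul

lemma coord_e (n k : ℕ) : (e n).coord k = if k = n then 1 else 0 := by
  simp [e, coord, Pi.single_apply]

/-- The operator on `J` given by a linear map `f` into the sequences that does not increase interval
square sums beyond the squared norm; it has norm at most `1`. -/
def contraction (f : JamesSpace →ₗ[ℝ] (ℕ → ℝ))
    (hf : ∀ x P, IsIntervalFamily P → ∑ I ∈ P, (∑ k ∈ I, f x k) ^ 2 ≤ ‖x‖ ^ 2) :
    JamesSpace →L[ℝ] JamesSpace :=
  let g : JamesSpace →ₗ[ℝ] JamesSpace :=
    { toFun x := ⟨f x, ‖x‖, by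
        rintro r ⟨P, hP, rfl⟩
        exact intervalNorm_le_of_sum_sq_le (norm_nonneg x) (hf x P hP)⟩
      map_add' x y := coord_injective (map_add f x y)
      map_smul' c x := coord_injective (map_smul f c x) }
  g.mkContinuous 1 fun x => by
    rw [one_mul]
    exact norm_le_of_sum_sq_le _ (norm_nonneg x) (hf x)

lemma norm_contraction_apply_le (f : JamesSpace →ₗ[ℝ] (ℕ → ℝ))
    (hf : ∀ x P, IsIntervalFamily P → ∑ I ∈ P, (∑ k ∈ I, f x k) ^ 2 ≤ ‖x‖ ^ 2) (x : JamesSpace) :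
    ‖contraction f hf x‖ ≤ ‖x‖ :=
  norm_le_of_sum_sq_le _ (norm_nonneg x) (hf x)

/-- The coordinate functional `x ↦ x(n)`. -/
def coordL (n : ℕ) : StrongDual ℝ JamesSpace :=
  LinearMap.mkContinuous
    { toFun x := x.coord n
      map_add' _ _ := rfl
      map_smul' _ _ := rfl } 1 fun x => by
    rw [one_mul]
    exact x.abs_coord_le_norm n

@[simp] lemma coordL_apply (n : ℕ) (x : JamesSpace) : coordL n x = x.coord n := rfl

lemma norm_coordL_le (n : ℕ) : ‖coordL n‖ ≤ 1 :=
  LinearMap.mkContinuous_norm_le _ zero_le_one _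

lemma norm_e_le (n : ℕ) : ‖e n‖ ≤ 1 := by
  refine norm_le_of_sum_sq_le _ zero_le_one fun P hP => ?_
  have h : ∀ I ∈ P, (∑ k ∈ I, (e n).coord k) ^ 2 = if n ∈ I then 1 else 0 := by
    intro I _
    simp only [coord_e, Finset.sum_ite_eq']
    split_ifs <;> simp
  rw [Finset.sum_congr rfl h, Finset.sum_boole, one_pow]
  norm_cast
  rw [Finset.card_le_one]
  intro I hI I' hI'
  rw [Finset.mem_filter] at hI hI'
  exact hP.2.elim_finset hI.1 hI'.1 n hI.2 hI'.2

/-! ### Completeness -/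

/-- Closed balls of `J` are closed under coordinatewise convergence. -/
lemma exists_coord_eq_of_tendsto {x : ℕ → JamesSpace} {C : ℝ} (hx : ∀ᶠ n in atTop, ‖x n‖ ≤ C)
    {a : ℕ → ℝ} (ha : ∀ k, Tendsto (fun n => (x n).coord k) atTop (𝓝 (a k))) :
    ∃ y : JamesSpace, y.coord = a ∧ ‖y‖ ≤ C := by
  have key : ∀ P, IsIntervalFamily P → intervalNorm P a ≤ C := by
    intro P hP
    have hlim : Tendsto (fun n => intervalNorm P (x n).coord) atTop (𝓝 (intervalNorm P a)) :=
      (tendsto_finsetSum _ fun I _ =>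
        ((tendsto_finsetSum _ fun k _ => ha k).abs.pow 2)).sqrt
    exact le_of_tendsto hlim (hx.mono fun n hn => ((x n).intervalNorm_le_norm hP).trans hn)
  refine ⟨⟨a, C, ?_⟩, rfl, norm_le_of_forall _ key⟩
  rintro r ⟨P, hP, rfl⟩
  exact key P hP

instance : CompleteSpace JamesSpace := by
  refine Metric.complete_of_cauchySeq_tendsto fun x hx => ?_
  have hc : ∀ k, ∃ a, Tendsto (fun n => (x n).coord k) atTop (𝓝 a) := fun k =>
    cauchySeq_tendsto_of_complete ((coordL k).uniformContinuous.comp_cauchySeq hx)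
  choose a ha using hc
  rw [Metric.cauchySeq_iff] at hx
  -- `a` is only known to be a sequence of reals; the vectors `x n - a` lie in `J` and are small.
  have key : ∀ ε > 0, ∃ N, ∀ n ≥ N, ∃ y : JamesSpace, y.coord = (x n).coord - a ∧ ‖y‖ ≤ ε := by
    intro ε hε
    obtain ⟨N, hN⟩ := hx ε hε
    refine ⟨N, fun n hn => ?_⟩
    refine exists_coord_eq_of_tendsto (x := fun m => x n - x m) ?_ fun k => ?_
    · filter_upwards [eventually_ge_atTop N] with m hm
      rw [← dist_eq_norm]
      exact (hN n hn m hm).le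
    · exact tendsto_const_nhds.sub (ha k)
  obtain ⟨N, hN⟩ := key 1 one_pos
  obtain ⟨y, hy, -⟩ := hN N le_rfl
  refine ⟨x N - y, ?_⟩
  rw [Metric.tendsto_atTop]
  intro ε hε
  obtain ⟨N', hN'⟩ := key (ε / 2) (half_pos hε)
  refine ⟨N', fun n hn => ?_⟩
  obtain ⟨z, hz, hzn⟩ := hN' n hn
  have : x n - (x N - y) = z := by
    apply coord_injective
    rw [coord_sub, coord_sub, hy, hz]
    abel
  rw [dist_eq_norm, this]
  linarith

/-! ### Restriction to intervals and tails -/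

open Classical in
/-- The restriction of a sequence to an interval `A` of `ℕ`, as an operator on `J`. -/
def restrict (A : Set ℕ) (hA : A.OrdConnected) : JamesSpace →L[ℝ] JamesSpace :=
  contraction
    { toFun x := A.indicator x.coord
      map_add' x y := Set.indicator_add _ _ _
      map_smul' c x := Set.indicator_const_smul A c x.coord }
    fun x P hP => by
      have h := x.sum_sq_le_norm_sq P (fun I => I.filter (· ∈ A))
        (fun I hI => by
          rw [Finset.coe_filter]
          exact (hP.1 I hI).inter hA)
        (fun I hI J hJ hIJ => Finset.disjoint_filter_filter (hP.2 hI hJ hIJ))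
      refine le_of_eq_of_le (Finset.sum_congr rfl fun I _ => ?_) h
      rw [Finset.sum_filter]
      exact congrArg (· ^ 2) (Finset.sum_congr rfl fun k _ => Set.indicator_apply A x.coord k)

@[simp] lemma coord_restrict (A : Set ℕ) (hA : A.OrdConnected) (x : JamesSpace) :
    (restrict A hA x).coord = A.indicator x.coord := rfl

lemma norm_restrict_le (A : Set ℕ) (hA : A.OrdConnected) (x : JamesSpace) :
    ‖restrict A hA x‖ ≤ ‖x‖ :=
  norm_contraction_apply_le _ _ _

/-- The restriction of a sequence to `[n, ∞)`. -/
abbrev tail (n : ℕ) : JamesSpace →L[ℝ] JamesSpace := restrict (Set.Ici n) Set.ordConnected_Ici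

/-- The unit vectors form a boundedly complete basis: the tails of an element tend to `0`, because
an almost norming family of intervals leaves little room beyond its last element. -/
lemma tendsto_tail (x : JamesSpace) : Tendsto (fun n => tail n x) atTop (𝓝 0) := by
  classical
  rw [Metric.tendsto_atTop]
  intro ε hε
  rcases (norm_nonneg x).eq_or_lt with h0 | hpos
  · refine ⟨0, fun n _ => ?_⟩
    rw [dist_zero_right]
    linarith [norm_restrict_le (Set.Ici n) Set.ordConnected_Ici x]
  obtain ⟨P, hP, hPx⟩ : ∃ P, IsIntervalFamily P ∧
      ‖x‖ ^ 2 - (ε / 2) ^ 2 < ∑ I ∈ P, (∑ k ∈ I, x.coord k) ^ 2 := by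
    by_contra! hcon
    have hle : ‖x‖ ≤ √(‖x‖ ^ 2 - (ε / 2) ^ 2) := x.norm_le_of_forall fun P hP => by
      have := hcon P hP
      simpa only [intervalNorm, sq_abs] using Real.sqrt_le_sqrt this
    have := (Real.le_sqrt' hpos).mp hle
    nlinarith
  obtain ⟨N, hN⟩ : ∃ N, ∀ I ∈ P, ∀ k ∈ I, k < N := by
    refine ⟨(P.sup id).sup id + 1, fun I hI k hk => Nat.lt_succ_of_le ?_⟩
    exact Finset.le_sup (f := id) (Finset.mem_sup.mpr ⟨I, hI, hk⟩)
  refine ⟨N, fun n hn => ?_⟩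
  rw [dist_zero_right]
  refine lt_of_le_of_lt (b := ε / 2) ?_ (by linarith)
  refine norm_le_of_sum_sq_le _ (by positivity) fun Q hQ => ?_
  -- `P` together with the traces of the members of `Q` on `[n, ∞)` is again a disjoint family.
  have h := x.sum_sq_le_norm_sq (P.disjSum Q) (Sum.elim id fun I => I.filter (n ≤ ·)) ?_ ?_
  · rw [Finset.sum_disjSum] at h
    have hQ' : ∑ I ∈ Q, (∑ k ∈ I, (tail n x).coord k) ^ 2
        = ∑ I ∈ Q, (∑ k ∈ I.filter (n ≤ ·), x.coord k) ^ 2 := by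
      simp [Finset.sum_filter, Set.indicator_apply]
    rw [hQ']
    simp only [Sum.elim_inl, Sum.elim_inr, id] at h
    linarith
  · rintro (I | I) hI
    · exact hP.1 I (by simpa using hI)
    · simp only [Sum.elim_inr, Finset.coe_filter]
      exact (hQ.1 I (by simpa using hI)).inter Set.ordConnected_Ici
  · rintro (I | I) hI (I' | I') hI' hne
    · exact hP.2 (by simpa using hI) (by simpa using hI') (by simpa using hne)
    · refine Finset.disjoint_left.mpr fun k hk hk' => ?_
      have := hN I (by simpa using hI) k hk
      simp only [Sum.elim_inr, Finset.mem_filter] at hk'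
      omega
    · refine Finset.disjoint_left.mpr fun k hk' hk => ?_
      have := hN I' (by simpa using hI') k hk
      simp only [Sum.elim_inr, Finset.mem_filter] at hk'
      omega
    · exact Finset.disjoint_filter_filter
        (hQ.2 (by simpa using hI) (by simpa using hI') (by simpa using hne))

lemma sub_sum_smul_e (x : JamesSpace) (n : ℕ) :
    x - ∑ k ∈ Finset.range n, x.coord k • e k = tail n x := by
  apply coord_injective
  funext j
  have : ∀ s : Finset ℕ, (∑ k ∈ s, x.coord k • e k).coord j = if j ∈ s then x.coord j else 0 := by
    intro s
    rw [← coordL_apply, map_sum]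
    simp [coord_e]
  rw [coord_sub, Pi.sub_apply, this, coord_restrict, Set.indicator_apply]
  by_cases h : j < n
  · simp [h]
  · simp [h, not_lt.mp h]

lemma tendsto_sum_smul_e (x : JamesSpace) :
    Tendsto (fun n => ∑ k ∈ Finset.range n, x.coord k • e k) atTop (𝓝 x) := by
  have h := (tendsto_const_nhds (x := x)).sub x.tendsto_tail
  simp only [sub_zero] at h
  refine h.congr fun n => ?_
  rw [← sub_sum_smul_e, sub_sub_cancel]

lemma dense_span_e : (Submodule.span ℝ (Set.range e)).topologicalClosure = ⊤ := by
  rw [eq_top_iff]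
  intro x _
  refine mem_closure_of_tendsto x.tendsto_sum_smul_e (Eventually.of_forall fun n => ?_)
  exact Submodule.sum_mem _ fun k _ => Submodule.smul_mem _ _ (Submodule.subset_span ⟨k, rfl⟩)

/-! ### The sum functional -/

lemma cauchySeq_sum_coord (x : JamesSpace) :
    CauchySeq fun n => ∑ k ∈ Finset.range n, x.coord k := by
  rw [Metric.cauchySeq_iff']
  intro ε hε
  obtain ⟨N, hN⟩ := (Metric.tendsto_atTop.mp x.tendsto_tail) ε hε
  refine ⟨N, fun n hn => ?_⟩
  have hN' := hN N le_rfl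
  rw [dist_zero_right] at hN'
  rw [Real.dist_eq, ← Finset.sum_Ico_eq_sub _ hn]
  refine lt_of_le_of_lt ?_ hN'
  have h := (tail N x).abs_sum_coord_le_norm (I := Finset.Ico N n)
    (by simpa using Set.ordConnected_Ico)
  rwa [Finset.sum_congr rfl fun k hk => ?_] at h
  simp [(Finset.mem_Ico.mp hk).1]

/-- The functional `x ↦ ∑ₖ x(k)`, a conditionally convergent sum. -/
def sumL : StrongDual ℝ JamesSpace :=
  continuousLinearMapOfTendsto (fun n => ∑ k ∈ Finset.range n, coordL k)
    (f := fun x => (cauchySeq_tendsto_of_complete x.cauchySeq_sum_coord).choose) <| by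
      rw [tendsto_pi_nhds]
      intro x
      simpa using (cauchySeq_tendsto_of_complete x.cauchySeq_sum_coord).choose_spec

lemma tendsto_sumL (x : JamesSpace) :
    Tendsto (fun n => ∑ k ∈ Finset.range n, x.coord k) atTop (𝓝 (sumL x)) :=
  (cauchySeq_tendsto_of_complete x.cauchySeq_sum_coord).choose_spec

@[simp] lemma sumL_e (n : ℕ) : sumL (e n) = 1 := by
  refine tendsto_nhds_unique (e n).tendsto_sumL
    (tendsto_const_nhds.congr' ?_)
  filter_upwards [eventually_gt_atTop n] with m hm
  simp [coord_e, hm]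

/-! ### Operators attached to a block partition -/

lemma exists_eq_Ico {I : Finset ℕ} (hI : (I : Set ℕ).OrdConnected) : ∃ p q, I = Finset.Ico p q := by
  rcases I.eq_empty_or_nonempty with rfl | hne
  · exact ⟨0, 0, by simp⟩
  refine ⟨I.min' hne, I.max' hne + 1, ?_⟩
  ext k
  rw [Finset.mem_Ico, Nat.lt_succ_iff]
  refine ⟨fun hk => ⟨I.min'_le k hk, I.le_max' k hk⟩, fun hk => ?_⟩
  exact_mod_cast hI.out (I.min'_mem hne) (I.max'_mem hne) hk

/-- The spread of a sequence along `m`, as an operator on `J`; it sends `eₖ` to `e_{m(k)}`. -/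
def spread (m : ℕ → ℕ) (hm : StrictMono m) : JamesSpace →L[ℝ] JamesSpace :=
  contraction
    { toFun x := Function.extend m x.coord 0
      map_add' x y := by
        rw [coord_add, ← Function.extend_add, add_zero]
      map_smul' c x := by
        rw [coord_smul, ← smul_zero c, Function.extend_smul]
        simp }
    fun x P hP => by
      have h := x.sum_sq_le_norm_sq P (fun I => I.preimage m hm.injective.injOn)
        (fun I hI => by
          rw [Finset.coe_preimage]
          exact (hP.1 I hI).preimage_mono hm.monotone)
        (fun I hI J hJ hIJ => by
          refine Finset.disjoint_left.mpr fun k hk hk' => ?_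
          rw [Finset.mem_preimage] at hk hk'
          exact Finset.disjoint_left.mp (hP.2 hI hJ hIJ) hk hk')
      refine le_of_eq_of_le (Finset.sum_congr rfl fun I _ => congrArg (· ^ 2) ?_) h
      refine Eq.trans ?_ (Finset.sum_congr rfl fun k _ => hm.injective.extend_apply x.coord 0 k)
      refine (Finset.sum_preimage m I hm.injective.injOn _ fun n _ hn => ?_).symm
      exact Function.extend_apply' _ _ _ fun ⟨k, hk⟩ => hn ⟨k, hk⟩

lemma spread_e (m : ℕ → ℕ) (hm : StrictMono m) (k : ℕ) : spread m hm (e k) = e (m k) := by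
  apply coord_injective
  funext n
  change Function.extend m (e k).coord 0 n = _
  by_cases h : ∃ j, m j = n
  · obtain ⟨j, rfl⟩ := h
    simp [hm.injective.extend_apply, coord_e, hm.injective.eq_iff]
  · rw [Function.extend_apply' _ _ _ h, coord_e, if_neg fun h' => h ⟨k, h'.symm⟩]
    rfl

lemma sum_Ico_sum_Ico {m : ℕ → ℕ} (hm : Monotone m) (x : ℕ → ℝ) {p q : ℕ} (hpq : p ≤ q) :
    ∑ k ∈ Finset.Ico p q, ∑ n ∈ Finset.Ico (m k) (m (k + 1)), x n
      = ∑ n ∈ Finset.Ico (m p) (m q), x n := by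
  obtain ⟨d, rfl⟩ := Nat.exists_eq_add_of_le hpq
  clear hpq
  induction d with
  | zero => simp
  | succ d ih =>
    rw [← add_assoc, Finset.sum_Ico_succ_top (Nat.le_add_right p d), ih]
    exact Finset.sum_Ico_consecutive _ (hm (Nat.le_add_right p d)) (hm (Nat.le_succ _))

/-- The operator on `J` that sums a sequence over the consecutive blocks `[m(k), m(k+1))`. -/
def blockSum (m : ℕ → ℕ) (hm : StrictMono m) : JamesSpace →L[ℝ] JamesSpace :=
  contraction
    { toFun x k := ∑ n ∈ Finset.Ico (m k) (m (k + 1)), x.coord n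
      map_add' x y := funext fun k => Finset.sum_add_distrib
      map_smul' c x := funext fun k => (Finset.mul_sum _ _ _).symm }
    fun x P hP => by
      -- `max p q` represents an empty interval with end points in the right order.
      have hdata : ∀ I : Finset ℕ, ∃ p q, I ∈ P → I = Finset.Ico p q ∧ p ≤ q := by
        intro I
        by_cases hI : I ∈ P
        · obtain ⟨p, q, h⟩ := exists_eq_Ico (hP.1 I hI)
          refine ⟨p, max p q, fun _ => ⟨?_, le_max_left _ _⟩⟩
          rw [h]
          ext k
          simp only [Finset.mem_Ico, lt_max_iff]
          omega
        · exact ⟨0, 0, fun h => absurd h hI⟩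
      choose p q hpq using hdata
      have h := x.sum_sq_le_norm_sq P (fun I => Finset.Ico (m (p I)) (m (q I)))
        (fun I hI => by simpa using Set.ordConnected_Ico)
        (fun I hI J hJ hIJ => by
          have hdis := hP.2 hI hJ hIJ
          obtain ⟨hI', hIle⟩ := hpq I hI
          obtain ⟨hJ', hJle⟩ := hpq J hJ
          rw [Function.onFun, id, id, hI', hJ'] at hdis
          refine Finset.disjoint_left.mpr fun n hn hn' => ?_
          rw [Finset.mem_Ico] at hn hn'
          have h1 := hm.lt_iff_lt.mp (hn.1.trans_lt hn.2)
          have h2 := hm.lt_iff_lt.mp (hn'.1.trans_lt hn'.2)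
          have h3 := hm.lt_iff_lt.mp (hn.1.trans_lt hn'.2)
          have h4 := hm.lt_iff_lt.mp (hn'.1.trans_lt hn.2)
          exact Finset.disjoint_left.mp hdis
            (Finset.mem_Ico.mpr ⟨le_max_left (p I) (p J), max_lt h1 h4⟩)
            (Finset.mem_Ico.mpr ⟨le_max_right _ _, max_lt h3 h2⟩))
      refine le_of_eq_of_le (Finset.sum_congr rfl fun I hI => congrArg (· ^ 2) ?_) h
      obtain ⟨hI', hle⟩ := hpq I hI
      exact (congrArg (fun K => ∑ k ∈ K, ∑ n ∈ Finset.Ico (m k) (m (k + 1)), x.coord n) hI').trans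
        (sum_Ico_sum_Ico hm.monotone x.coord hle)

lemma coord_blockSum (m : ℕ → ℕ) (hm : StrictMono m) (x : JamesSpace) (k : ℕ) :
    (blockSum m hm x).coord k = ∑ n ∈ Finset.Ico (m k) (m (k + 1)), x.coord n := rfl

lemma norm_blockSum_le (m : ℕ → ℕ) (hm : StrictMono m) (x : JamesSpace) :
    ‖blockSum m hm x‖ ≤ ‖x‖ :=
  norm_contraction_apply_le _ _ _

lemma blockSum_e (m : ℕ → ℕ) (hm : StrictMono m) (k : ℕ) : blockSum m hm (e (m k)) = e k := by
  apply coord_injective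
  funext j
  simp only [coord_blockSum, coord_e, Finset.sum_ite_eq', Finset.mem_Ico, hm.le_iff_le,
    hm.lt_iff_lt]
  congr 1
  rw [eq_iff_iff]
  omega

lemma blockSum_tail (m : ℕ → ℕ) (hm : StrictMono m) (x : JamesSpace) :
    blockSum m hm (tail (m 0) x) = blockSum m hm x := by
  apply coord_injective
  funext j
  rw [coord_blockSum, coord_blockSum]
  refine Finset.sum_congr rfl fun n hn => ?_
  rw [coord_restrict, Set.indicator_of_mem]
  exact (hm.monotone j.zero_le).trans (Finset.mem_Ico.mp hn).1

/-! ### Blocks with vanishing sum -/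

/-- A sequence of vectors whose `k`-th term is supported in `[m(k), m(k+1))` and has coordinates
with sum zero. -/
structure IsZeroSumBlocks (m : ℕ → ℕ) (w : ℕ → JamesSpace) : Prop where
  coord_eq_zero : ∀ k n, n ∉ Finset.Ico (m k) (m (k + 1)) → (w k).coord n = 0
  sum_eq_zero : ∀ k, ∑ n ∈ Finset.Ico (m k) (m (k + 1)), (w k).coord n = 0

namespace IsZeroSumBlocks

variable {m : ℕ → ℕ} {w : ℕ → JamesSpace}

/-- The initial sums of a zero-sum block vanish unless they end inside the block. -/
lemma sum_range_eq_zero (hw : IsZeroSumBlocks m w) {k p : ℕ} (hp : ¬ (m k ≤ p ∧ p < m (k + 1))) :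
    ∑ n ∈ Finset.range p, (w k).coord n = 0 := by
  by_cases h : m k ≤ p
  · rw [← hw.sum_eq_zero k]
    symm
    refine Finset.sum_subset (fun n hn => ?_) fun n _ hn => hw.coord_eq_zero k n hn
    have := (Finset.mem_Ico.mp hn).2
    exact Finset.mem_range.mpr (by omega)
  · refine Finset.sum_eq_zero fun n hn => hw.coord_eq_zero k n fun hn' => ?_
    have := (Finset.mem_Ico.mp hn').1
    have := Finset.mem_range.mp hn
    omega

lemma card_straddling_le_one (hm : StrictMono m) (p : ℕ) (s : Finset ℕ) :
    (s.filter fun k => m k ≤ p ∧ p < m (k + 1)).card ≤ 1 := by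
  rw [Finset.card_le_one]
  intro i hi j hj
  rw [Finset.mem_filter] at hi hj
  have h1 := hm.lt_iff_lt.mp (hi.2.1.trans_lt hj.2.2)
  have h2 := hm.lt_iff_lt.mp (hj.2.1.trans_lt hi.2.2)
  omega

/-- Bounded zero-sum blocks satisfy an upper `ℓ²` estimate: an interval only sees the two blocks
that its end points cut. -/
lemma norm_sum_smul_le (hm : StrictMono m) (hw : IsZeroSumBlocks m w) {M : ℝ}
    (hM : ∀ k, ‖w k‖ ≤ M) (a : ℕ → ℝ) (s : Finset ℕ) :
    ‖∑ k ∈ s, a k • w k‖ ≤ √(2 * M ^ 2 * ∑ k ∈ s, a k ^ 2) := by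
  classical
  have hM0 : 0 ≤ M := (norm_nonneg _).trans (hM 0)
  have hnn : 0 ≤ 2 * M ^ 2 * ∑ k ∈ s, a k ^ 2 := by positivity
  refine norm_le_of_sum_sq_le _ (Real.sqrt_nonneg _) fun P hP => ?_
  rw [Real.sq_sqrt hnn]
  have hI : ∀ I ∈ P, (∑ n ∈ I, (∑ k ∈ s, a k • w k).coord n) ^ 2
      ≤ 2 * ∑ k ∈ s, (a k * ∑ n ∈ I, (w k).coord n) ^ 2 := by
    intro I hI
    have hcoord : ∀ n, (∑ k ∈ s, a k • w k).coord n = ∑ k ∈ s, a k * (w k).coord n := by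
      intro n
      rw [← coordL_apply, map_sum]
      simp
    simp only [hcoord]
    rw [Finset.sum_comm]
    simp only [← Finset.mul_sum]
    obtain ⟨p, q, rfl⟩ := exists_eq_Ico (hP.1 I hI)
    rcases le_total q p with hqp | hpq
    · simp [Finset.Ico_eq_empty_of_le hqp]
    -- Only the at most two blocks that contain an end point of `[p, q)` contribute.
    set t := s.filter (fun k => m k ≤ p ∧ p < m (k + 1)) ∪
      s.filter (fun k => m k ≤ q ∧ q < m (k + 1)) with ht
    have hts : t ⊆ s := Finset.union_subset (Finset.filter_subset _ _) (Finset.filter_subset _ _)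
    have hcard : (t.card : ℝ) ≤ 2 := by
      have h := Finset.card_union_le (s.filter fun k => m k ≤ p ∧ p < m (k + 1))
        (s.filter fun k => m k ≤ q ∧ q < m (k + 1))
      have h1 := card_straddling_le_one hm p s
      have h2 := card_straddling_le_one hm q s
      exact_mod_cast h.trans (by omega)
    have hzero : ∀ k ∈ s, k ∉ t → a k * ∑ n ∈ Finset.Ico p q, (w k).coord n = 0 := by
      intro k hk hkt
      simp only [ht, Finset.mem_union, Finset.mem_filter, hk, true_and, not_or] at hkt
      rw [Finset.sum_Ico_eq_sub _ hpq, hw.sum_range_eq_zero hkt.1, hw.sum_range_eq_zero hkt.2]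
      simp
    rw [← Finset.sum_subset hts hzero]
    calc _ ≤ (t.card : ℝ) * ∑ k ∈ t, (a k * ∑ n ∈ Finset.Ico p q, (w k).coord n) ^ 2 :=
          sq_sum_le_card_mul_sum_sq
      _ ≤ 2 * ∑ k ∈ s, (a k * ∑ n ∈ Finset.Ico p q, (w k).coord n) ^ 2 := by
          gcongr
  calc _ ≤ ∑ I ∈ P, 2 * ∑ k ∈ s, (a k * ∑ n ∈ I, (w k).coord n) ^ 2 := Finset.sum_le_sum hI
    _ = 2 * ∑ k ∈ s, a k ^ 2 * ∑ I ∈ P, (∑ n ∈ I, (w k).coord n) ^ 2 := by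
        rw [← Finset.mul_sum, Finset.sum_comm]
        simp only [mul_pow, ← Finset.mul_sum]
    _ ≤ 2 * ∑ k ∈ s, a k ^ 2 * M ^ 2 := by
        gcongr with k hk
        refine ((w k).sum_sq_le_norm_sq_of_isIntervalFamily hP).trans ?_
        have := hM k
        gcongr
    _ = 2 * M ^ 2 * ∑ k ∈ s, a k ^ 2 := by
        rw [← Finset.sum_mul]
        ring

/-- The coordinates of an element of `J` are square summable, so that bounded zero-sum blocks are
the images of the unit vectors under an operator. It has values in the kernel of `blockSum`. -/
lemma exists_operator (hm : StrictMono m) (hw : IsZeroSumBlocks m w) {M : ℝ}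
    (hM : ∀ k, ‖w k‖ ≤ M) :
    ∃ W : JamesSpace →L[ℝ] JamesSpace, (∀ k, W (e k) = w k) ∧ ∀ x, blockSum m hm (W x) = 0 := by
  have hsum : ∀ x : JamesSpace, Summable fun k => x.coord k • w k := by
    intro x
    have hsq : Summable fun k => x.coord k ^ 2 :=
      summable_of_sum_le (fun k => sq_nonneg _) fun s => x.sum_coord_sq_le s
    rw [summable_iff_vanishing_norm]
    intro ε hε
    obtain ⟨s, hs⟩ := (summable_iff_vanishing_norm.mp hsq) (ε ^ 2 / (2 * M ^ 2 + 1)) (by positivity)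
    refine ⟨s, fun t ht => ?_⟩
    have hnn : 0 ≤ ∑ k ∈ t, x.coord k ^ 2 := Finset.sum_nonneg fun k _ => sq_nonneg _
    have h := hs t ht
    rw [Real.norm_of_nonneg hnn, lt_div_iff₀ (by positivity)] at h
    refine (norm_sum_smul_le hm hw hM x.coord t).trans_lt ?_
    rw [Real.sqrt_lt' hε]
    nlinarith
  have hlim : Tendsto (fun n x => (∑ k ∈ Finset.range n, (coordL k).smulRight (w k)) x) atTop
      (𝓝 fun x => ∑' k, x.coord k • w k) := by
    rw [tendsto_pi_nhds]
    intro x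
    simpa using (hsum x).hasSum.tendsto_sum_nat
  refine ⟨continuousLinearMapOfTendsto _ hlim, fun k => ?_, fun x => ?_⟩
  · change ∑' j, (e k).coord j • w j = w k
    rw [tsum_eq_single k]
    · simp [coord_e]
    · intro j hj
      simp [coord_e, hj]
  · change blockSum m hm (∑' k, x.coord k • w k) = 0
    have hzero : ∀ k, blockSum m hm (w k) = 0 := by
      intro k
      apply coord_injective
      funext j
      rw [coord_blockSum, coord_zero]
      rcases eq_or_ne j k with rfl | hjk
      · exact hw.sum_eq_zero j
      · refine Finset.sum_eq_zero fun n hn => hw.coord_eq_zero k n fun hn' => hjk ?_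
        rw [Finset.mem_Ico] at hn hn'
        have h1 := hm.lt_iff_lt.mp (hn.1.trans_lt hn'.2)
        have h2 := hm.lt_iff_lt.mp (hn'.1.trans_lt hn.2)
        omega
    rw [(blockSum m hm).map_tsum (hsum x)]
    simp [hzero]

/-- Functionals cannot tend to a nonzero limit along bounded zero-sum blocks, by comparing the
arithmetic means with the upper `ℓ²` estimate. -/
lemma eq_zero_of_tendsto (hm : StrictMono m) (hw : IsZeroSumBlocks m w) {M : ℝ}
    (hM : ∀ k, ‖w k‖ ≤ M) (f : StrongDual ℝ JamesSpace) {L : ℝ}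
    (hL : Tendsto (fun k => f (w k)) atTop (𝓝 L)) : L = 0 := by
  refine tendsto_nhds_unique hL.cesaro ?_
  have hbound : ∀ n : ℕ, ‖(n⁻¹ : ℝ) * ∑ k ∈ Finset.range n, f (w k)‖
      ≤ ‖f‖ * √(2 * M ^ 2) * (√n)⁻¹ := by
    intro n
    have h := norm_sum_smul_le hm hw hM (fun _ => 1) (Finset.range n)
    simp only [one_smul, one_pow, Finset.sum_const, Finset.card_range, nsmul_eq_mul,
      mul_one] at h
    rw [Real.sqrt_mul (by positivity)] at h
    rw [← map_sum, norm_mul, norm_inv, Real.norm_natCast]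
    calc (n : ℝ)⁻¹ * ‖f (∑ k ∈ Finset.range n, w k)‖
        ≤ (n : ℝ)⁻¹ * (‖f‖ * (√(2 * M ^ 2) * √n)) := by
          gcongr
          exact (f.le_opNorm _).trans (by gcongr)
      _ = ‖f‖ * √(2 * M ^ 2) * (√n / n) := by ring
      _ = ‖f‖ * √(2 * M ^ 2) * (√n)⁻¹ := by rw [Real.sqrt_div_self]
  refine squeeze_zero_norm hbound ?_
  have h : Tendsto (fun n : ℕ => (√(n : ℝ))⁻¹) atTop (𝓝 0) :=
    (Real.tendsto_sqrt_atTop.comp tendsto_natCast_atTop_atTop).inv_tendsto_atTop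
  simpa only [mul_zero] using h.const_mul (‖f‖ * √(2 * M ^ 2))

end IsZeroSumBlocks

/-! ### Extraction of blocks -/

/-- One step of the gliding hump: far out in a coordinatewise null sequence whose sums tend to `l`
there is a term close to `l • e p + w` with `w` a zero-sum vector on an interval `[p, q)`. -/
lemma exists_zeroSum_block {y : ℕ → JamesSpace} {M l : ℝ} (hM : ∀ n, ‖y n‖ ≤ M)
    (hy : ∀ k, Tendsto (fun n => (y n).coord k) atTop (𝓝 0))
    (hl : Tendsto (fun n => sumL (y n)) atTop (𝓝 l)) {ε : ℝ} (hε : 0 < ε) (i p : ℕ) :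
    ∃ j q, ∃ w d : JamesSpace, i < j ∧ p < q ∧
      (∀ n, n ∉ Finset.Ico p q → w.coord n = 0) ∧ ∑ n ∈ Finset.Ico p q, w.coord n = 0 ∧
      ‖w‖ ≤ 2 * M ∧ ‖d‖ ≤ ε ∧ y j = l • e p + w + d := by
  -- The error consists of the head and the tail of `y j`, of norm `ε / 5` each, and of a multiple
  -- of `e p` with a coefficient of size `3 * (ε / 5)`.
  have hε' : 0 < ε / 5 := by positivity
  have hhead : Tendsto (fun n => ∑ k ∈ Finset.range p, |(y n).coord k|) atTop (𝓝 0) := by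
    simpa using tendsto_finsetSum (Finset.range p) fun k _ => (hy k).abs
  obtain ⟨j, hij, hj₁, hj₂⟩ := ((eventually_gt_atTop i).and
    ((hhead.eventually_lt_const hε').and (Metric.tendsto_nhds.mp hl _ hε'))).exists
  obtain ⟨q, hpq, hq₁, hq₂⟩ := ((eventually_gt_atTop p).and
    ((Metric.tendsto_nhds.mp (y j).tendsto_tail _ hε').and
      (Metric.tendsto_nhds.mp (y j).tendsto_sumL _ hε'))).exists
  rw [dist_zero_right] at hq₁
  rw [Real.dist_eq] at hj₂ hq₂
  set b : ℝ := ∑ n ∈ Finset.Ico p q, (y j).coord n with hb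
  set r : JamesSpace := restrict (Set.Ico p q) Set.ordConnected_Ico (y j) with hr
  set h : JamesSpace := ∑ k ∈ Finset.range p, (y j).coord k • e k with hh
  have hbM : |b| ≤ M := ((y j).abs_sum_coord_le_norm (by simpa using Set.ordConnected_Ico)).trans
    (hM j)
  have hsmul : ∀ (c : ℝ) n, ‖c • e n‖ ≤ |c| := fun c n => by
    rw [norm_smul, Real.norm_eq_abs]
    exact mul_le_of_le_one_right (abs_nonneg c) (norm_e_le n)
  have hsplit : y j = h + r + tail q (y j) := by
    have h1 : h = y j - tail p (y j) := by rw [← sub_sum_smul_e, sub_sub_cancel]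
    rw [h1]
    apply coord_injective
    funext n
    simp only [coord_add, coord_sub, coord_restrict, Pi.add_apply, Pi.sub_apply, hr,
      Set.indicator_apply, Set.mem_Ici, Set.mem_Ico]
    split_ifs <;> first | omega | simp
  have hhn : ‖h‖ ≤ ε / 5 := by
    refine (norm_sum_le _ _).trans (le_trans ?_ hj₁.le)
    exact Finset.sum_le_sum fun k _ => hsmul _ _
  have hbl : |b - l| ≤ 3 * (ε / 5) := by
    have h1 : b = ∑ n ∈ Finset.range q, (y j).coord n - ∑ n ∈ Finset.range p, (y j).coord n :=
      Finset.sum_Ico_eq_sub _ hpq.le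
    have h2 : |∑ n ∈ Finset.range p, (y j).coord n| ≤ ε / 5 :=
      (Finset.abs_sum_le_sum_abs _ _).trans hj₁.le
    rw [h1]
    rw [abs_le] at h2 ⊢
    rw [abs_lt] at hj₂ hq₂
    constructor <;> linarith [h2.1, h2.2, hj₂.1, hj₂.2, hq₂.1, hq₂.2]
  refine ⟨j, q, r - b • e p, h + tail q (y j) + (b - l) • e p, hij, hpq, ?_, ?_, ?_, ?_, ?_⟩
  · intro n hn
    have hnp : n ≠ p := by
      rintro rfl
      exact hn (Finset.mem_Ico.mpr ⟨le_rfl, hpq⟩)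
    rw [Finset.mem_Ico] at hn
    simp [hr, coord_e, hnp, hn]
  · have h1 : ∑ n ∈ Finset.Ico p q, r.coord n = b := by
      refine Finset.sum_congr rfl fun n hn => ?_
      rw [hr, coord_restrict, Set.indicator_of_mem]
      simpa using hn
    simp [coord_e, Finset.sum_sub_distrib, h1, hpq]
  · have h1 : ‖r‖ ≤ M := (norm_restrict_le _ _ _).trans (hM j)
    linarith [norm_sub_le r (b • e p), hsmul b p]
  · linarith [norm_add₃_le (a := h) (b := tail q (y j)) (c := (b - l) • e p), hsmul (b - l) p]
  · conv_lhs => rw [hsplit]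
    rw [sub_smul]
    abel

/-- The gliding hump argument. A bounded coordinatewise null sequence whose sums tend to `l` has a
subsequence that is, up to a summable error, of the form `l • e (m k) + w k` with bounded zero-sum
blocks `w k` that start at `m k`. -/
lemma exists_subsequence_eq_blocks {y : ℕ → JamesSpace} {M l : ℝ} (hM : ∀ n, ‖y n‖ ≤ M)
    (hy : ∀ k, Tendsto (fun n => (y n).coord k) atTop (𝓝 0))
    (hl : Tendsto (fun n => sumL (y n)) atTop (𝓝 l)) {ε : ℝ} (hε : 0 < ε) (N : ℕ) :
    ∃ (φ m : ℕ → ℕ) (w d : ℕ → JamesSpace), StrictMono φ ∧ StrictMono m ∧ m 0 = N ∧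
      IsZeroSumBlocks m w ∧ (∀ k, ‖w k‖ ≤ 2 * M) ∧ (∀ k, ‖d k‖ ≤ ε / 2 / 2 ^ k) ∧
      ∀ k, y (φ k) = l • e (m k) + w k + d k := by
  have hstep := fun k : ℕ => exists_zeroSum_block hM hy hl (ε := ε / 2 / 2 ^ k) (by positivity)
  choose j q w d h using hstep
  -- The state is the last index used together with the start of the next block.
  let st : ℕ → ℕ × ℕ := fun k =>
    Nat.rec (0, N) (fun k s => (j k s.1 s.2, q k s.1 s.2)) k
  have hst := fun k => h k (st k).1 (st k).2
  refine ⟨fun k => (st (k + 1)).1, fun k => (st k).2, fun k => w k (st k).1 (st k).2,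
    fun k => d k (st k).1 (st k).2, strictMono_nat_of_lt_succ fun k => (hst (k + 1)).1,
    strictMono_nat_of_lt_succ fun k => (hst k).2.1, rfl,
    ⟨fun k => (hst k).2.2.1, fun k => (hst k).2.2.2.1⟩, fun k => (hst k).2.2.2.2.1,
    fun k => (hst k).2.2.2.2.2.1, fun k => (hst k).2.2.2.2.2.2⟩

/-! ### The dichotomy for coordinatewise convergent sequences -/

/-- Coordinates and sums determine weak limits: if they converge along a bounded sequence to those
of `x`, then no functional has a limit other than its value at `x`. -/
lemma eq_of_tendsto_of_sumL {x : ℕ → JamesSpace} {M : ℝ} (hM : ∀ n, ‖x n‖ ≤ M)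
    {x₀ : JamesSpace} (hx : ∀ k, Tendsto (fun n => (x n).coord k) atTop (𝓝 (x₀.coord k)))
    (hs : Tendsto (fun n => sumL (x n)) atTop (𝓝 (sumL x₀))) (f : StrongDual ℝ JamesSpace) {L : ℝ}
    (hf : Tendsto (fun n => f (x n)) atTop (𝓝 L)) : L = f x₀ := by
  have hM' : ∀ n, ‖x n - x₀‖ ≤ M + ‖x₀‖ := fun n =>
    (norm_sub_le _ _).trans (by linarith [hM n])
  have hl : Tendsto (fun n => sumL (x n - x₀)) atTop (𝓝 0) := by
    simpa using hs.sub_const (sumL x₀)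
  obtain ⟨φ, m, w, d, hφ, hm, -, hw, hwM, hd, h⟩ := exists_subsequence_eq_blocks hM'
    (fun k => by simpa using (hx k).sub_const (x₀.coord k)) hl one_pos 0
  have hd0 : Tendsto d atTop (𝓝 0) :=
    squeeze_zero_norm hd (hasSum_geometric_two' 1).summable.tendsto_atTop_zero
  rw [← sub_eq_zero]
  refine hw.eq_zero_of_tendsto hm hwM f ?_
  have h1 : Tendsto (fun k => f (x (φ k)) - f x₀ - f (d k)) atTop (𝓝 (L - f x₀ - 0)) := by
    refine ((hf.comp hφ.tendsto_atTop).sub_const _).sub ?_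
    simpa [Function.comp_def] using (f.continuous.tendsto 0).comp hd0
  rw [sub_zero] at h1
  refine h1.congr fun k => ?_
  rw [← map_sub, h k, ← map_sub]
  simp

/-- If along a bounded coordinatewise convergent sequence the sums do not tend to the sum of the
limit, then a subsequence is the image of the unit vector basis under an operator with a bounded
left inverse. -/
lemma exists_leftInverse_of_sumL_ne {x : ℕ → JamesSpace} {M μ : ℝ} (hM : ∀ n, ‖x n‖ ≤ M)
    {x₀ : JamesSpace} (hx : ∀ k, Tendsto (fun n => (x n).coord k) atTop (𝓝 (x₀.coord k)))
    (hs : Tendsto (fun n => sumL (x n)) atTop (𝓝 μ)) (hne : μ ≠ sumL x₀) :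
    ∃ φ : ℕ → ℕ, StrictMono φ ∧ ∃ T A : JamesSpace →L[ℝ] JamesSpace,
      (∀ k, T (e k) = x (φ k)) ∧ Function.LeftInverse A T := by
  set l : ℝ := μ - sumL x₀
  have hl0 : l ≠ 0 := sub_ne_zero.mpr hne
  have hlpos : 0 < |l| := abs_pos.mpr hl0
  obtain ⟨N, hN⟩ : ∃ N, ‖sumL‖ * ‖tail N x₀‖ < |l| / 4 := by
    have h : Tendsto (fun N => ‖sumL‖ * ‖tail N x₀‖) atTop (𝓝 0) := by
      simpa using (x₀.tendsto_tail.norm).const_mul ‖sumL‖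
    exact (h.eventually_lt_const (by positivity)).exists
  have hM' : ∀ n, ‖x n - x₀‖ ≤ M + ‖x₀‖ := fun n =>
    (norm_sub_le _ _).trans (by linarith [hM n])
  have hl' : Tendsto (fun n => sumL (x n - x₀)) atTop (𝓝 l) := by
    simpa using hs.sub_const (sumL x₀)
  obtain ⟨φ, m, w, d, hφ, hm, hm0, hw, hwM, hd, h⟩ := exists_subsequence_eq_blocks hM'
    (fun k => by simpa using (hx k).sub_const (x₀.coord k)) hl'
    (ε := |l| / 4) (by positivity) N
  obtain ⟨W, hWe, hW⟩ := hw.exists_operator hm hwM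
  have hdn : ∀ k, ‖(coordL k).smulRight (d k)‖ ≤ |l| / 4 / 2 / 2 ^ k := fun k => by
    rw [ContinuousLinearMap.norm_smulRight_apply]
    exact (mul_le_of_le_one_left (norm_nonneg _) (norm_coordL_le k)).trans (hd k)
  have hgeom := hasSum_geometric_two' (|l| / 4)
  have hEs : Summable fun k => (coordL k).smulRight (d k) := .of_norm_bounded hgeom.summable hdn
  -- The error operator `E` sends `e k` to `d k`.
  set E : JamesSpace →L[ℝ] JamesSpace := ∑' k, (coordL k).smulRight (d k) with hE
  have hEn : ‖E‖ ≤ |l| / 4 := tsum_of_norm_bounded hgeom hdn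
  have hEe : ∀ k, E (e k) = d k := fun k => by
    have h1 := (ContinuousLinearMap.apply ℝ JamesSpace (e k)).map_tsum hEs
    simp only [ContinuousLinearMap.apply_apply, ContinuousLinearMap.smulRight_apply,
      coordL_apply] at h1
    rw [hE, h1, tsum_eq_single k]
    · simp [coord_e]
    · intro j hj
      simp [coord_e, hj]
  set S := spread m hm with hS
  set R := blockSum m hm with hR
  have hRS : R ∘L S = ContinuousLinearMap.id ℝ JamesSpace := by
    refine ContinuousLinearMap.ext_on
      (Submodule.dense_iff_topologicalClosure_eq_top.mpr dense_span_e) ?_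
    rintro _ ⟨k, rfl⟩
    simp [hR, hS, spread_e, blockSum_e]
  set T : JamesSpace →L[ℝ] JamesSpace := sumL.smulRight x₀ + l • S + W + E with hT
  set t : JamesSpace →L[ℝ] JamesSpace := -(l⁻¹ • (R ∘L (sumL.smulRight x₀ + E))) with ht
  -- `l⁻¹ R T` is the identity up to the perturbation `t`, as `R S = 1` and `R W = 0`.
  have hRT : ∀ a, l⁻¹ • R (T a) = a - t a := fun a => by
    have h1 : R (S a) = a := congrArg (· a) hRS
    simp only [hT, ht, add_apply, smul_apply, neg_apply, ContinuousLinearMap.comp_apply,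
      ContinuousLinearMap.smulRight_apply, map_add, map_smul, h1, hW, smul_add, smul_smul,
      inv_mul_cancel₀ hl0, one_smul, smul_zero]
    abel
  have htn : ‖t‖ < 1 := by
    refine lt_of_le_of_lt (b := 1 / 2) (ContinuousLinearMap.opNorm_le_bound _ (by norm_num)
      fun a => ?_) (by norm_num)
    -- `R` ignores the coordinates of `x₀` before the first block, which starts at `N`.
    have h1 : ‖R (sumL a • x₀)‖ ≤ |l| / 4 * ‖a‖ := by
      rw [hR, ← blockSum_tail, hm0]
      calc _ ≤ ‖tail N (sumL a • x₀)‖ := norm_blockSum_le _ _ _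
        _ = ‖sumL a‖ * ‖tail N x₀‖ := by rw [map_smul, norm_smul]
        _ ≤ ‖sumL‖ * ‖a‖ * ‖tail N x₀‖ := by gcongr; exact sumL.le_opNorm a
        _ = ‖sumL‖ * ‖tail N x₀‖ * ‖a‖ := by ring
        _ ≤ |l| / 4 * ‖a‖ := by gcongr
    have h2 : ‖R (E a)‖ ≤ |l| / 4 * ‖a‖ :=
      (norm_blockSum_le _ _ _).trans (E.le_of_opNorm_le hEn a)
    have h3 : t a = -(l⁻¹ • (R (sumL a • x₀) + R (E a))) := by
      rw [← map_add]
      rfl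
    rw [h3, norm_neg, norm_smul, norm_inv, Real.norm_eq_abs, inv_mul_le_iff₀ hlpos]
    refine (norm_add_le _ _).trans ?_
    linarith
  refine ⟨φ, hφ, T, (↑(Units.oneSub t htn)⁻¹ : JamesSpace →L[ℝ] JamesSpace) ∘L (l⁻¹ • R),
    fun k => ?_, fun a => ?_⟩
  · rw [sub_eq_iff_eq_add'.mp (h k), hT]
    simp [hS, spread_e, hWe, hEe, add_assoc]
  · have h1 : (↑(Units.oneSub t htn)⁻¹ : JamesSpace →L[ℝ] JamesSpace) * (1 - t) = 1 :=
      (Units.oneSub t htn).inv_mul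
    have h2 := congrArg (· a) h1
    rw [ContinuousLinearMap.comp_apply, smul_apply, hRT]
    exact h2

end JamesSpace

/-! ### Approximation of bidual elements on countably many functionals -/

/-- Helly's theorem: on finitely many functionals an element of the bidual is approximated by
vectors of at most the same norm. -/
lemma exists_norm_le_forall_abs_sub_lt {X ι : Type*} [NormedAddCommGroup X] [NormedSpace ℝ X]
    [Fintype ι] (z : StrongDual ℝ (StrongDual ℝ X)) (g : ι → StrongDual ℝ X) {δ : ℝ} (hδ : 0 < δ) :
    ∃ v : X, ‖v‖ ≤ ‖z‖ ∧ ∀ i, |g i v - z (g i)| < δ := by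
  classical
  set G : X →L[ℝ] (ι → ℝ) := ContinuousLinearMap.pi g
  set p : ι → ℝ := fun i => z (g i)
  -- Otherwise a functional on `ι → ℝ` separates `p` from the image of the ball; it corresponds to
  -- a combination `h` of the `g i` with `‖z‖ * ‖h‖ < z h`.
  have hp : p ∈ closure (G '' Metric.closedBall 0 ‖z‖) := by
    by_contra hp
    have hconv : Convex ℝ (closure (G '' Metric.closedBall 0 ‖z‖)) :=
      ((convex_closedBall 0 ‖z‖).linear_image G.toLinearMap).closure
    obtain ⟨f, u, hfu, hu⟩ := geometric_hahn_banach_closed_point hconv isClosed_closure hp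
    have hf : ∀ a : ι → ℝ, f a = ∑ i, a i * f fun j => if i = j then 1 else 0 := fun a =>
      LinearMap.pi_apply_eq_sum_univ f.toLinearMap a
    set h : StrongDual ℝ X := f ∘L G
    have hz : z h = f p := by
      have hh : h = ∑ i, (f fun j => if i = j then 1 else 0) • g i := by
        ext v
        rw [ContinuousLinearMap.comp_apply, hf]
        simp [G, mul_comm]
      rw [hh, map_sum, hf]
      simp [p, mul_comm]
    have hle : ∀ v, ‖v‖ ≤ ‖z‖ → h v < u := fun v hv =>
      hfu _ (subset_closure ⟨v, by simpa using hv, rfl⟩)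
    have hnorm : ‖z‖ * ‖h‖ ≤ u := by
      have hu0 : 0 ≤ u := by
        have := hle 0 (by rw [norm_zero]; exact norm_nonneg z)
        rw [map_zero] at this
        exact this.le
      rcases (norm_nonneg z).eq_or_lt with h0 | hpos
      · rwa [← h0, zero_mul]
      rw [mul_comm, ← le_div_iff₀ hpos]
      refine ContinuousLinearMap.opNorm_le_of_unit_norm (by positivity) fun v hv => ?_
      rw [le_div_iff₀ hpos, Real.norm_eq_abs]
      have h1 := hle (‖z‖ • v) (by simp [norm_smul, hv, abs_of_pos hpos])
      have h2 := hle (-(‖z‖ • v)) (by simp [norm_smul, hv, abs_of_pos hpos])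
      rw [map_neg, map_smul, smul_eq_mul] at h2
      rw [map_smul, smul_eq_mul] at h1
      rcases abs_cases (h v) with ⟨h3, -⟩ | ⟨h3, -⟩ <;> rw [h3] <;> linarith
    have := (le_abs_self _).trans (z.le_opNorm h)
    linarith
  obtain ⟨_, ⟨v, hv, rfl⟩, hvd⟩ := Metric.mem_closure_iff.mp hp δ hδ
  refine ⟨v, by simpa using hv, fun i => ?_⟩
  rw [← Real.dist_eq, dist_comm]
  exact (dist_le_pi_dist p (G v) i).trans_lt hvd

lemma exists_seq_forall_tendsto {X : Type*} [NormedAddCommGroup X] [NormedSpace ℝ X]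
    (z : StrongDual ℝ (StrongDual ℝ X)) (g : ℕ → StrongDual ℝ X) :
    ∃ v : ℕ → X, (∀ n, ‖v n‖ ≤ ‖z‖) ∧ ∀ i, Tendsto (fun n => g i (v n)) atTop (𝓝 (z (g i))) := by
  have h := fun n : ℕ => exists_norm_le_forall_abs_sub_lt z (fun i : Fin (n + 1) => g i)
    (Nat.one_div_pos_of_nat (α := ℝ) (n := n))
  choose v hv hvg using h
  refine ⟨v, hv, fun i => ?_⟩
  rw [tendsto_iff_dist_tendsto_zero]
  refine squeeze_zero' (Eventually.of_forall fun _ => dist_nonneg) ?_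
    tendsto_one_div_add_atTop_nhds_zero_nat
  filter_upwards [eventually_ge_atTop i] with n hn
  exact (hvg n ⟨i, Nat.lt_succ_of_le hn⟩).le

/-- A bidual element of a closed subspace is a point of the subspace as soon as it acts on the
functionals of the whole space like a point of the whole space. -/
lemma mem_range_inclusionInDoubleDual_of_forall_subtypeL {X : Type*} [NormedAddCommGroup X]
    [NormedSpace ℝ X] {Z : Submodule ℝ X} (hZ : IsClosed (Z : Set X))
    (z : StrongDual ℝ (StrongDual ℝ Z)) {x : X}
    (hx : ∀ f : StrongDual ℝ X, z (f ∘L Z.subtypeL) = f x) :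
    z ∈ Set.range (NormedSpace.inclusionInDoubleDual ℝ Z) := by
  have hxZ : x ∈ Z := by
    by_contra hxZ
    obtain ⟨f, u, hfu, hu⟩ := geometric_hahn_banach_closed_point Z.convex hZ hxZ
    have hu0 : 0 < u := by simpa using hfu 0 Z.zero_mem
    have hf0 : f ∘L Z.subtypeL = 0 := by
      ext v
      by_contra hv
      have hv' : f v ≠ 0 := hv
      have := hfu ((u / f v) • (v : X)) (Z.smul_mem _ v.2)
      rw [map_smul, smul_eq_mul, div_mul_cancel₀ _ hv'] at this
      exact lt_irrefl _ this
    have := hx f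
    rw [hf0, map_zero] at this
    linarith
  refine ⟨⟨x, hxZ⟩, ?_⟩
  ext g
  obtain ⟨f, hf, -⟩ := exists_extension_norm_eq Z g
  have hfg : f ∘L Z.subtypeL = g := ContinuousLinearMap.ext hf
  rw [NormedSpace.dual_def, ← hfg, hx]
  rfl

/-! ### Complemented copies of the James space -/

namespace JamesSpace

variable {x : ℕ → JamesSpace} {T A : JamesSpace →L[ℝ] JamesSpace}

lemma seqEquivalent_of_leftInverse (hT : ∀ k, T (e k) = x k) (hA : Function.LeftInverse A T) :
    SeqEquivalent x e := by
  have hc : ∀ a : ℕ →₀ ℝ,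
      Finsupp.linearCombination ℝ x a = T (Finsupp.linearCombination ℝ e a) := fun a => by
    have hx : x = T ∘ e := funext fun k => (hT k).symm
    rw [hx]
    exact (Finsupp.apply_linearCombination ℝ T.toLinearMap e a).symm
  refine ⟨(‖A‖ + 1)⁻¹, ‖T‖ + 1, by positivity, by positivity, fun a => ?_⟩
  rw [hc]
  set v := Finsupp.linearCombination ℝ e a
  refine ⟨?_, ?_⟩
  · rw [inv_mul_le_iff₀ (by positivity)]
    calc ‖v‖ = ‖A (T v)‖ := by rw [hA]
      _ ≤ (‖A‖ + 1) * ‖T v‖ := A.le_of_opNorm_le (by linarith) _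
  · exact T.le_of_opNorm_le (by linarith) _

lemma closedSpan_eq_range (hT : ∀ k, T (e k) = x k) (hA : Function.LeftInverse A T) :
    closedSpan x = T.range := by
  refine le_antisymm ?_ ?_
  · refine Submodule.topologicalClosure_minimal _ ?_
      (T.closedComplemented_range_of_leftInverse A hA).isClosed
    rw [Submodule.span_le]
    rintro _ ⟨k, rfl⟩
    exact ⟨e k, hT k⟩
  · rintro _ ⟨v, rfl⟩
    have hv : v ∈ closure (Submodule.span ℝ (Set.range e) : Set JamesSpace) := by
      have : v ∈ (Submodule.span ℝ (Set.range e)).topologicalClosure := by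
        rw [dense_span_e]
        trivial
      exact this
    refine map_mem_closure T.continuous hv fun u hu => ?_
    induction hu using Submodule.span_induction with
    | mem u hu =>
      obtain ⟨k, rfl⟩ := hu
      exact Submodule.subset_span ⟨k, (hT k).symm⟩
    | zero => simp
    | add u u' _ _ hu hu' =>
      rw [map_add]
      exact Submodule.add_mem _ hu hu'
    | smul c u _ hu =>
      rw [map_smul]
      exact Submodule.smul_mem _ _ hu

lemma nonempty_range_equiv (hA : Function.LeftInverse A T) :
    Nonempty (T.range ≃L[ℝ] JamesSpace) :=
  ⟨.equivOfInverse (A ∘L T.range.subtypeL) T.rangeRestrict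
    (by
      rintro ⟨_, v, rfl⟩
      exact Subtype.ext (congrArg T (hA v)))
    fun v => hA v⟩

/-- The limit functional `z` of a non-trivial weakly Cauchy sequence is not evaluation at the
coordinatewise limit `x₀`, so that it differs from it already on the sum functional. -/
theorem exists_subsequence_equivalent_complemented {x : ℕ → JamesSpace}
    (hx : IsNontrivialWeaklyCauchy x) :
    ∃ φ : ℕ → ℕ, StrictMono φ ∧ SeqEquivalent (fun k => x (φ k)) e ∧
      (closedSpan fun k => x (φ k)).ClosedComplemented := by
  obtain ⟨z, hz, hlim⟩ := hx
  have hf : ∀ f : StrongDual ℝ JamesSpace, Tendsto (fun n => f (x n)) atTop (𝓝 (z f)) :=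
    fun f => ((WeakDual.eval_continuous f).tendsto _).comp hlim
  obtain ⟨M, hM⟩ : ∃ M, ∀ n, ‖x n‖ ≤ M := by
    obtain ⟨M, hM⟩ := banach_steinhaus
      (g := fun n => NormedSpace.inclusionInDoubleDual ℝ JamesSpace (x n)) fun f => by
        obtain ⟨C, hC⟩ := (Metric.isBounded_range_of_tendsto _ (hf f)).exists_norm_le
        exact ⟨C, fun n => hC _ ⟨n, rfl⟩⟩
    refine ⟨M, fun n => ?_⟩
    rw [← (NormedSpace.inclusionInDoubleDualLi ℝ (E := JamesSpace)).norm_map]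
    exact hM n
  obtain ⟨x₀, hx₀, -⟩ := exists_coord_eq_of_tendsto (Eventually.of_forall hM)
    fun k => hf (coordL k)
  have hcoord : ∀ k, Tendsto (fun n => (x n).coord k) atTop (𝓝 (x₀.coord k)) := fun k => by
    rw [hx₀]
    exact hf (coordL k)
  have hne : z sumL ≠ sumL x₀ := fun h => hz ⟨x₀, by
    ext f
    exact (eq_of_tendsto_of_sumL hM hcoord (h ▸ hf sumL) f (hf f)).symm⟩
  obtain ⟨φ, hφ, T, A, hT, hA⟩ := exists_leftInverse_of_sumL_ne hM hcoord (hf sumL) hne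
  refine ⟨φ, hφ, seqEquivalent_of_leftInverse hT hA, ?_⟩
  rw [closedSpan_eq_range hT hA]
  exact T.closedComplemented_range_of_leftInverse A hA

/-- The copy of `J` is spanned by a sequence in `Z` that follows an element of the bidual of `Z`
outside `Z` on the coordinates and on the sum functional. -/
theorem exists_complemented_copy_of_not_isReflexiveSpace {Z : Submodule ℝ JamesSpace}
    (hZ : IsClosed (Z : Set JamesSpace)) (hrefl : ¬ IsReflexiveSpace Z) :
    ∃ W : Submodule ℝ JamesSpace, W ≤ Z ∧ Nonempty (W ≃L[ℝ] JamesSpace) ∧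
      W.ClosedComplemented := by
  obtain ⟨z, hz⟩ : ∃ z, z ∉ Set.range (NormedSpace.inclusionInDoubleDual ℝ Z) :=
    not_forall.mp hrefl
  -- Bounded sequences in `Z` on which the coordinates, the sum and one more functional tend to
  -- the values that `z` prescribes.
  have hseq : ∀ f : StrongDual ℝ JamesSpace, ∃ (M : ℝ) (v : ℕ → Z),
      (∀ n, ‖(v n : JamesSpace)‖ ≤ M) ∧
      (∀ k, Tendsto (fun n => (v n : JamesSpace).coord k) atTop
        (𝓝 (z (coordL k ∘L Z.subtypeL)))) ∧
      Tendsto (fun n => sumL (v n)) atTop (𝓝 (z (sumL ∘L Z.subtypeL))) ∧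
      Tendsto (fun n => f (v n)) atTop (𝓝 (z (f ∘L Z.subtypeL))) := by
    intro f
    obtain ⟨v, hv, hlim⟩ := exists_seq_forall_tendsto z fun i =>
      (Nat.casesOn i sumL fun i => Nat.casesOn i f coordL : StrongDual ℝ JamesSpace) ∘L Z.subtypeL
    exact ⟨_, v, hv, fun k => hlim (k + 2), hlim 0, hlim 1⟩
  obtain ⟨M, v, hvM, hvc, hvs, -⟩ := hseq 0
  obtain ⟨x₀, hx₀, -⟩ := exists_coord_eq_of_tendsto (Eventually.of_forall hvM) hvc
  have hne : z (sumL ∘L Z.subtypeL) ≠ sumL x₀ := by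
    intro h
    refine hz (mem_range_inclusionInDoubleDual_of_forall_subtypeL hZ z (x := x₀) fun f => ?_)
    obtain ⟨M, v, hvM, hvc, hvs, hvf⟩ := hseq f
    simp only [← congrFun hx₀] at hvc
    exact eq_of_tendsto_of_sumL hvM hvc (h ▸ hvs) f hvf
  simp only [← congrFun hx₀] at hvc
  obtain ⟨φ, -, T, A, hT, hA⟩ := exists_leftInverse_of_sumL_ne hvM hvc hvs hne
  refine ⟨T.range, ?_, nonempty_range_equiv hA, T.closedComplemented_range_of_leftInverse A hA⟩
  rw [← closedSpan_eq_range hT hA]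
  refine Submodule.topologicalClosure_minimal _ ?_ hZ
  rw [Submodule.span_le]
  rintro _ ⟨k, rfl⟩
  exact (v (φ k)).2

end JamesSpace

end

theorem mainTheorem10 :
    (∀ x : ℕ → JamesSpace, IsNontrivialWeaklyCauchy x →
      ∃ φ : ℕ → ℕ, StrictMono φ ∧
        SeqEquivalent (fun k => x (φ k)) JamesSpace.e ∧
        (closedSpan fun k => x (φ k)).ClosedComplemented) ∧
    (∀ Z : Submodule ℝ JamesSpace, IsClosed (Z : Set JamesSpace) → ¬ IsReflexiveSpace Z →
      ∃ W : Submodule ℝ JamesSpace, W ≤ Z ∧ Nonempty (W ≃L[ℝ] JamesSpace) ∧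
        W.ClosedComplemented) :=
  ⟨fun _ hx => JamesSpace.exists_subsequence_equivalent_complemented hx,
    fun _ hZ hrefl => JamesSpace.exists_complemented_copy_of_not_isReflexiveSpace hZ hrefl⟩
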